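/- Formulas of the language $\mathsf L_{[\cdot]}$ are built from $\bot$ and countably many propositional variables using $\neg$, $\wedge$ and a modality $[\xi]$ for each natural number $\xi$; $\langle\xi\rangle$ abbreviates $\neg[\xi]\neg$ and $\phi\to\psi$ abbreviates $\neg(\phi\wedge\neg\psi)$. For a binary relation $\prec$ on $\mathbb N$, the logic $\mathsf{GLP}_\prec$ has as axioms all propositional tautologies of this language and, for all formulas $\phi,\psi$, 1. $[\xi](\phi\to\psi)\to([\xi]\phi\to[\xi]\psi)$ for all $\xi$, 2. $[\xi]([\xi]\phi\to\phi)\to[\xi]\phi$ for all $\xi$, 3. $\langle\zeta\rangle\phi\to\langle\xi\rangle\phi$ for $\xi\prec\zeta$, 4. $\langle\xi\rangle\phi\to[\zeta]\langle\xi\rangle\phi$ for $\xi\prec\zeta$, and as rules modus ponens, substitution of formulas for propositional variables, and necessitation (from $\phi$ infer $[\xi]\phi$, for any $\xi$). $\mathsf{GLP}_\omega$ is $\mathsf{GLP}_<$ for the usual strict order $<$ on $\mathbb N$. If $\prec$ is a strict linear order on $\mathbb N$ and $\lambda_0\prec\lambda_1\prec\dots\prec\lambda_N$ are the modalities occurring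 in $\phi$, the condensation $\overline\phi$ (with respect to $\prec$) is the formula that results from $\phi$ by simultaneously replacing each occurrence of $[\lambda_i]$ by $[i]$; if no modality occurs in $\phi$, then $\overline\phi=\phi$. **Corollary.** Let $\prec$ be a recursive (strict) well-order of the set of all natural numbers and let $\phi$ be any formula of $\mathsf L_{[\cdot]}$. Then $$\mathsf{GLP}_\prec\vdash\phi\quad\Longleftrightarrow\quad\mathsf{GLP}_\omega\vdash\overline\phi.$$ -/

import Mathlib

/-- Formulas of the polymodal language: built from falsum and countably many propositional
variables with negation, conjunction and one modality for each natural number. -/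
inductive ModalFormula : Type
  | var : ℕ → ModalFormula
  | bot : ModalFormula
  | neg : ModalFormula → ModalFormula
  | and : ModalFormula → ModalFormula → ModalFormula
  | box : ℕ → ModalFormula → ModalFormula

namespace ModalFormula

/-- Material implication, as an abbreviation. -/
def imp (φ ψ : ModalFormula) : ModalFormula := neg (and φ (neg ψ))

/-- The dual modality. -/
def dia (ξ : ℕ) (φ : ModalFormula) : ModalFormula := neg (box ξ (neg φ))

/-- Simultaneous substitution of formulas for propositional variables. -/
def subst (s : ℕ → ModalFormula) : ModalFormula → ModalFormula
  | var p => s p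
  | bot => bot
  | neg φ => neg (subst s φ)
  | and φ ψ => and (subst s φ) (subst s ψ)
  | box ξ φ => box ξ (subst s φ)

/-- Propositional truth value, where variables and boxed formulas are treated as atoms that
receive their truth values from `v`. -/
def PropEval (v : ModalFormula → Prop) : ModalFormula → Prop
  | var p => v (var p)
  | bot => False
  | neg φ => ¬ PropEval v φ
  | and φ ψ => PropEval v φ ∧ PropEval v ψ
  | box ξ φ => v (box ξ φ)

/-- Propositional tautologies in the modal language. -/
def IsTautology (φ : ModalFormula) : Prop := ∀ v : ModalFormula → Prop, PropEval v φ

/-- The finite set of (indices of) modalities that occur in a formula. -/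
def modalities : ModalFormula → Finset ℕ
  | var _ => ∅
  | bot => ∅
  | neg φ => modalities φ
  | and φ ψ => modalities φ ∪ modalities ψ
  | box ξ φ => insert ξ (modalities φ)

/-- Simultaneous replacement of each modality `[ξ]` by `[g ξ]`. -/
def rename (g : ℕ → ℕ) : ModalFormula → ModalFormula
  | var p => var p
  | bot => bot
  | neg φ => neg (rename g φ)
  | and φ ψ => and (rename g φ) (rename g ψ)
  | box ξ φ => box (g ξ) (rename g φ)

end ModalFormula

open ModalFormula in
/-- Derivability in the logic `GLP` of a binary relation `r` on the naturals, where `r ξ ζ` is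
read as `ξ ≺ ζ`. -/
inductive GLP (r : ℕ → ℕ → Prop) : ModalFormula → Prop
  | tautology (φ : ModalFormula) : IsTautology φ → GLP r φ
  | distrib (ξ : ℕ) (φ ψ : ModalFormula) :
      GLP r (imp (box ξ (imp φ ψ)) (imp (box ξ φ) (box ξ ψ)))
  | loeb (ξ : ℕ) (φ : ModalFormula) :
      GLP r (imp (box ξ (imp (box ξ φ) φ)) (box ξ φ))
  | monotone (ξ ζ : ℕ) (φ : ModalFormula) : r ξ ζ →
      GLP r (imp (dia ζ φ) (dia ξ φ))
  | introspection (ξ ζ : ℕ) (φ : ModalFormula) : r ξ ζ →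
      GLP r (imp (dia ξ φ) (box ζ (dia ξ φ)))
  | modusPonens (φ ψ : ModalFormula) : GLP r (imp φ ψ) → GLP r φ → GLP r ψ
  | substitution (s : ℕ → ModalFormula) (φ : ModalFormula) : GLP r φ → GLP r (subst s φ)
  | necessitation (ξ : ℕ) (φ : ModalFormula) : GLP r φ → GLP r (box ξ φ)

/-- Derivability in `GLP_ω`, i.e. for the usual strict order on the naturals. -/
def GLPomega (φ : ModalFormula) : Prop := GLP (fun m n : ℕ => m < n) φ

/-- A binary relation on the naturals is recursive if it is decidable by an algorithm. -/
def IsRecursiveRelation (r : ℕ → ℕ → Prop) : Prop :=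
  ComputablePred (fun p : ℕ × ℕ => r p.1 p.2)

open Classical in
/-- The position of `k` in the finite set `S` listed in increasing `r`-order, counted from `0`:
the number of elements of `S` strictly below `k`. -/
noncomputable def orderPosition (r : ℕ → ℕ → Prop) (S : Finset ℕ) (k : ℕ) : ℕ :=
  (S.filter (fun l => r l k)).card

/-- The condensation of `φ`: if `λ_0 ≺ … ≺ λ_N` are the modalities that occur in `φ`, then each
occurrence of `[λ_i]` is replaced by `[i]`. -/
noncomputable def condensation (r : ℕ → ℕ → Prop) (φ : ModalFormula) : ModalFormula :=
  φ.rename (orderPosition r φ.modalities)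

/-- The defining property of positions: the `i`-th element of an increasing enumeration of `S`
has position `i`. -/
theorem orderPosition_enum (r : ℕ → ℕ → Prop) [IsWellOrder ℕ r] (S : Finset ℕ) (n : ℕ)
    (e : Fin n → ℕ) (he : ∀ i j : Fin n, i < j → r (e i) (e j))
    (hS : ∀ k : ℕ, k ∈ S ↔ ∃ i : Fin n, e i = k) (i : Fin n) :
    orderPosition r S (e i) = i := by
  classical
  have hirr : ∀ k : ℕ, ¬ r k k := fun k => irrefl_of r k
  have hiff : ∀ a b : Fin n, r (e a) (e b) ↔ a < b := by
    intro a b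
    refine ⟨fun h => ?_, he a b⟩
    rcases lt_trichotomy a b with hab | hab | hab
    · exact hab
    · subst hab
      exact absurd h (hirr _)
    · exact absurd (trans_of r h (he b a hab)) (hirr _)
  have hinj : Function.Injective e := by
    intro a b hab
    rcases lt_trichotomy a b with h | h | h
    · exact absurd (hab ▸ he a b h) (hirr _)
    · exact h
    · exact absurd (hab ▸ he b a h) (hirr _)
  have hset : S.filter (fun l => r l (e i)) = (Finset.Iio i).image e := by
    ext k
    simp only [Finset.mem_filter, Finset.mem_image, Finset.mem_Iio, hS]
    constructor
    · rintro ⟨⟨a, rfl⟩, h⟩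
      exact ⟨a, (hiff a i).1 h, rfl⟩
    · rintro ⟨a, h, rfl⟩
      exact ⟨⟨a, rfl⟩, he a i h⟩
  unfold orderPosition
  rw [Finset.filter_congr_decidable, hset, Finset.card_image_of_injective _ hinj, Fin.card_Iio]

/-! Derivations can be renamed along order-preserving maps, and a derivation in GLP_≺ uses axioms 3
and 4 for finitely many modalities only. Both directions thus rest on conservativity (`GLP.of_lt`):
a theorem φ of GLP_ω is derivable with axioms 3 and 4 restricted to modalities of φ. A renaming that
is injective on these can then be undone.

Conservativity is semantic. If the restricted logic does not prove φ, then φ fails in a canonical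
model whose relations look only at the finitely many boxed subformulas of φ. This is a J-model, so
it validates every axiom except 3; axiom 3 holds for the boxed subformulas of φ (`MonotoneOn`) and
vacuously from the largest modality on (`MonotoneFrom`). It is repaired one level k at a time,
downwards. `blowUp` takes, for each root u, copies of the part above u along relations beyond k,
indexed by ordinals, and lets R_k also lead into lower copies. Truth of a formula stabilises below
each level, so an R_m-successor with m > k has an R_k-successor in a lower copy that agrees with it
on a given formula. Hence axiom 3 now holds from level k on (`monotoneFrom_blowUp`), while φ keeps
its truth values (`sat_blowUp_iff`). At level 0 the model is sound for GLP_ω and still refutes φ. -/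

namespace ModalFormula

/-! ### Renaming, substitution and valuations -/

theorem propEval_imp (v : ModalFormula → Prop) (φ ψ : ModalFormula) :
    PropEval v (imp φ ψ) ↔ (PropEval v φ → PropEval v ψ) := by
  simp only [imp, PropEval]
  tauto

theorem rename_subst (g : ℕ → ℕ) (s : ℕ → ModalFormula) (φ : ModalFormula) :
    rename g (subst s φ) = subst (fun p => rename g (s p)) (rename g φ) := by
  induction φ <;> simp_all [rename, subst]

theorem subst_subst (s t : ℕ → ModalFormula) (φ : ModalFormula) :
    subst s (subst t φ) = subst (fun p => subst s (t p)) φ := by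
  induction φ <;> simp_all [subst]

theorem subst_var (φ : ModalFormula) : subst var φ = φ := by
  induction φ <;> simp_all [subst]

theorem rename_rename (g h : ℕ → ℕ) (φ : ModalFormula) :
    rename g (rename h φ) = rename (fun k => g (h k)) φ := by
  induction φ <;> simp_all [rename]

theorem rename_congr (g h : ℕ → ℕ) (φ : ModalFormula) (H : ∀ k ∈ modalities φ, g k = h k) :
    rename g φ = rename h φ := by
  induction φ <;> simp_all [rename, modalities]

theorem rename_id (φ : ModalFormula) : rename (fun k => k) φ = φ := by
  induction φ <;> simp_all [rename]

theorem modalities_rename (g : ℕ → ℕ) (φ : ModalFormula) :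
    modalities (rename g φ) = (modalities φ).image g := by
  induction φ <;> simp_all [rename, modalities, Finset.image_union]

theorem propEval_rename (g : ℕ → ℕ) (v : ModalFormula → Prop) (φ : ModalFormula) :
    PropEval v (rename g φ) ↔ PropEval (fun ψ => v (rename g ψ)) φ := by
  induction φ <;> simp_all [rename, PropEval]

/-- The finite set of formulas that occur in `φ` directly under a modality. -/
def boxBodies : ModalFormula → Set ModalFormula
  | var _ => ∅
  | bot => ∅
  | neg φ => boxBodies φ
  | and φ ψ => boxBodies φ ∪ boxBodies ψ
  | box _ φ => insert φ (boxBodies φ)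

theorem finite_boxBodies (φ : ModalFormula) : (boxBodies φ).Finite := by
  induction φ <;> simp_all [boxBodies]

/-- A set of formulas that contains the tautologies and is closed under modus ponens. -/
structure IsTheory (T : Set ModalFormula) : Prop where
  taut : ∀ φ, IsTautology φ → φ ∈ T
  mp : ∀ φ ψ, imp φ ψ ∈ T → φ ∈ T → ψ ∈ T

namespace IsTheory

variable {T : Set ModalFormula}

theorem mp_taut (hT : IsTheory T) {φ ψ : ModalFormula} (hφ : φ ∈ T)
    (h : ∀ v, PropEval v φ → PropEval v ψ) : ψ ∈ T :=
  hT.mp φ ψ (hT.taut _ fun v => (propEval_imp v φ ψ).2 (h v)) hφ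

theorem mp_taut₂ (hT : IsTheory T) {φ ψ χ : ModalFormula} (hφ : φ ∈ T) (hψ : ψ ∈ T)
    (h : ∀ v, PropEval v φ → PropEval v ψ → PropEval v χ) : χ ∈ T :=
  hT.mp ψ χ (hT.mp_taut hφ fun v hv => (propEval_imp v ψ χ).2 (h v hv)) hψ

/-- The theory obtained by adding one formula. -/
theorem adjoin (hT : IsTheory T) (θ : ModalFormula) : IsTheory {ψ | imp θ ψ ∈ T} where
  taut φ hφ := hT.taut _ fun v => (propEval_imp v θ φ).2 fun _ => hφ v
  mp φ ψ h₁ h₂ := hT.mp_taut₂ h₁ h₂ fun v => by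
    simp only [propEval_imp]
    tauto

/-- Lindenbaum's lemma, in terms of propositional valuations. -/
theorem exists_valuation (hT : IsTheory T) {χ : ModalFormula} (hχ : χ ∉ T) :
    ∃ v : ModalFormula → Prop, (∀ θ ∈ T, PropEval v θ) ∧ ¬ PropEval v χ := by
  obtain ⟨M, hTM, hM⟩ := zorn_subset_nonempty {S : Set ModalFormula | IsTheory S ∧ χ ∉ S} (by
    intro c hc hchain hne
    refine ⟨⋃₀ c, ⟨⟨?_, ?_⟩, ?_⟩, fun s hs => Set.subset_sUnion_of_mem hs⟩
    · intro φ hφ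
      obtain ⟨s, hs⟩ := hne
      exact ⟨s, hs, (hc hs).1.taut φ hφ⟩
    · rintro φ ψ ⟨s, hs, h₁⟩ ⟨t, ht, h₂⟩
      rcases hchain.total hs ht with h | h
      · exact ⟨t, ht, (hc ht).1.mp φ ψ (h h₁) h₂⟩
      · exact ⟨s, hs, (hc hs).1.mp φ ψ h₁ (h h₂)⟩
    · rintro ⟨s, hs, h⟩
      exact (hc hs).2 h) T ⟨hT, hχ⟩
  have hMT : IsTheory M := hM.prop.1
  -- By maximality, adjoining θ to M must yield χ.
  have key : ∀ θ, θ ∉ M → imp θ χ ∈ M := by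
    intro θ hθ
    by_contra h
    have hsub : M ⊆ {ψ | imp θ ψ ∈ M} := fun ψ hψ => hMT.mp_taut hψ fun v hv =>
      (propEval_imp v θ ψ).2 fun _ => hv
    exact hθ (hM.le_of_ge ⟨hMT.adjoin θ, h⟩ hsub
      (hMT.taut _ fun v => (propEval_imp v θ θ).2 id))
  have heval : ∀ θ, PropEval (fun ψ => ψ ∈ M) θ ↔ θ ∈ M := by
    intro θ
    induction θ with
    | var p => rfl
    | box ξ φ => rfl
    | bot => exact ⟨False.elim, fun h => hM.prop.2 (hMT.mp_taut h fun v hv => hv.elim)⟩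
    | neg φ ih =>
      simp only [PropEval, ih]
      constructor
      · intro h
        by_contra h'
        refine hM.prop.2 (hMT.mp_taut₂ (key _ h) (key _ h') fun v => ?_)
        simp only [propEval_imp, PropEval]
        tauto
      · intro h h'
        exact hM.prop.2 (hMT.mp_taut₂ h h' fun v h₁ h₂ => (h₁ h₂).elim)
    | and φ ψ ih₁ ih₂ =>
      simp only [PropEval, ih₁, ih₂]
      exact ⟨fun h => hMT.mp_taut₂ h.1 h.2 fun v h₁ h₂ => ⟨h₁, h₂⟩,
        fun h => ⟨hMT.mp_taut h fun v hv => hv.1, hMT.mp_taut h fun v hv => hv.2⟩⟩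
  exact ⟨fun ψ => ψ ∈ M, fun θ hθ => (heval θ).2 (hTM hθ), fun h => hM.prop.2 ((heval χ).1 h)⟩

end IsTheory

end ModalFormula

open ModalFormula

/-! ### Renaming and finite support of derivations -/

namespace GLP

variable {r s : ℕ → ℕ → Prop}

theorem rename (h : ℕ → ℕ) (H : ∀ ξ ζ, s ξ ζ → r (h ξ) (h ζ)) {φ : ModalFormula}
    (hφ : GLP s φ) : GLP r (rename h φ) := by
  induction hφ with
  | tautology φ hφ => exact .tautology _ fun v => (propEval_rename h v φ).2 (hφ _)
  | distrib ξ φ ψ => exact .distrib _ _ _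
  | loeb ξ φ => exact .loeb _ _
  | monotone ξ ζ φ hr => exact .monotone _ _ _ (H _ _ hr)
  | introspection ξ ζ φ hr => exact .introspection _ _ _ (H _ _ hr)
  | modusPonens φ ψ _ _ h₁ h₂ => exact .modusPonens _ _ h₁ h₂
  | substitution t φ _ ih =>
    rw [rename_subst]
    exact .substitution _ _ ih
  | necessitation ξ φ _ ih => exact .necessitation _ _ ih

theorem mono (H : ∀ ξ ζ, s ξ ζ → r ξ ζ) {φ : ModalFormula} (hφ : GLP s φ) : GLP r φ := by
  simpa only [rename_id] using hφ.rename (fun k => k) H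

theorem exists_finset {φ : ModalFormula} (hφ : GLP r φ) :
    ∃ S : Finset ℕ, GLP (fun ξ ζ => ξ ∈ S ∧ ζ ∈ S ∧ r ξ ζ) φ := by
  classical
  induction hφ with
  | tautology φ hφ => exact ⟨∅, .tautology _ hφ⟩
  | distrib ξ φ ψ => exact ⟨∅, .distrib _ _ _⟩
  | loeb ξ φ => exact ⟨∅, .loeb _ _⟩
  | monotone ξ ζ φ hr => exact ⟨{ξ, ζ}, .monotone _ _ _ (by simp [hr])⟩
  | introspection ξ ζ φ hr => exact ⟨{ξ, ζ}, .introspection _ _ _ (by simp [hr])⟩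
  | modusPonens φ ψ _ _ h₁ h₂ =>
    obtain ⟨S, hS⟩ := h₁
    obtain ⟨T, hT⟩ := h₂
    refine ⟨S ∪ T, .modusPonens φ ψ (hS.mono ?_) (hT.mono ?_)⟩ <;>
    · intro ξ ζ h
      simp [h.1, h.2.1, h.2.2]
  | substitution t φ _ ih => exact ih.imp fun S hS => .substitution _ _ hS
  | necessitation ξ φ _ ih => exact ih.imp fun S hS => .necessitation _ _ hS

theorem isTheory (r : ℕ → ℕ → Prop) : IsTheory {φ | GLP r φ} where
  taut := .tautology
  mp := .modusPonens

/-- Propositional valuations under which all theorems of the logic are true; these are the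
maximal consistent sets. -/
def World (r : ℕ → ℕ → Prop) : Type :=
  {v : ModalFormula → Prop // ∀ θ, GLP r θ → PropEval v θ}

/-! ### Maximal consistent sets -/

namespace World

variable (x : World r) {m j : ℕ} {φ ψ : ModalFormula}

theorem box_mp (h : x.1 (box m (imp φ ψ))) (hφ : x.1 (box m φ)) : x.1 (box m ψ) := by
  have := x.2 _ (GLP.distrib m φ ψ)
  simp only [propEval_imp] at this
  exact this h hφ

theorem box_isTheory (m : ℕ) : IsTheory {φ | x.1 (box m φ)} where
  taut φ hφ := x.2 _ (.necessitation m φ (.tautology φ hφ))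
  mp _ _ h₁ h₂ := x.box_mp h₁ h₂

theorem box_of_imp (h : GLP r (imp φ ψ)) (hφ : x.1 (box m φ)) : x.1 (box m ψ) :=
  x.box_mp (x.2 _ (.necessitation m _ h)) hφ

theorem box_loeb (h : x.1 (box m (imp (box m φ) φ))) : x.1 (box m φ) := by
  have := x.2 _ (GLP.loeb m φ)
  rw [propEval_imp] at this
  exact this h

/-- Löb's axiom applied to φ ∧ [m]φ gives transitivity. -/
theorem box_box (h : x.1 (box m φ)) : x.1 (box m (box m φ)) := by
  have h₁ : GLP r (imp (box m (and φ (box m φ))) (box m φ)) :=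
    .modusPonens _ _ (.distrib m _ _) (.necessitation m _ (.tautology _ fun v => by
      simp only [propEval_imp, PropEval]
      tauto))
  have h₂ : x.1 (box m (and φ (box m φ))) := by
    refine x.box_loeb ((x.box_isTheory m).mp_taut₂ h (x.2 _ (.necessitation m _ h₁)) fun v => ?_)
    simp only [propEval_imp, PropEval]
    tauto
  exact (x.box_isTheory m).mp_taut h₂ fun v hv => hv.2

theorem box_neg_neg (m : ℕ) (φ : ModalFormula) : x.1 (box m (neg (neg φ))) ↔ x.1 (box m φ) :=
  ⟨fun h => (x.box_isTheory m).mp_taut h fun v => by simp [PropEval],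
    fun h => (x.box_isTheory m).mp_taut h fun v => by simp [PropEval]⟩

theorem box_of_lt (hr : r j m) (h : x.1 (box j φ)) : x.1 (box m φ) := by
  have := x.2 _ (GLP.monotone j m (neg φ) hr)
  simp only [propEval_imp, PropEval, dia, box_neg_neg] at this
  tauto

theorem box_neg_box (hr : r j m) (h : ¬ x.1 (box j φ)) : x.1 (box m (neg (box j φ))) := by
  have h₁ := x.2 _ (GLP.introspection j m (neg φ) hr)
  simp only [propEval_imp, PropEval, dia, box_neg_neg] at h₁
  refine x.box_of_imp ?_ (h₁ h)
  have h₂ : GLP r (imp (box j φ) (box j (neg (neg φ)))) :=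
    .modusPonens _ _ (.distrib j _ _) (.necessitation j _ (.tautology _ fun v => by
      simp [propEval_imp, PropEval]))
  refine (GLP.isTheory r).mp_taut h₂ fun v => ?_
  simp only [propEval_imp, PropEval]
  tauto

/-- The existence lemma for the canonical model. -/
theorem exists_of_not_box (h : ¬ x.1 (box m φ)) :
    ∃ y : World r, ¬ PropEval y.1 φ ∧ y.1 (box m φ) ∧
      ∀ ψ, x.1 (box m ψ) → PropEval y.1 ψ := by
  have hT := (x.box_isTheory m).adjoin (box m φ)
  -- If φ followed from [m]φ in the theory of x, Löb's axiom would make [m]φ true at x.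
  obtain ⟨v, hv, hvφ⟩ := hT.exists_valuation (χ := φ) fun h' => h (x.box_loeb h')
  have hsub : ∀ ψ, x.1 (box m ψ) → PropEval v ψ := fun ψ hψ =>
    hv ψ ((x.box_isTheory m).mp_taut hψ fun w hw => (propEval_imp w _ _).2 fun _ => hw)
  refine ⟨⟨v, fun θ hθ => hsub θ (x.2 _ (.necessitation m θ hθ))⟩, hvφ, ?_, hsub⟩
  exact hv (box m φ) ((x.box_isTheory m).taut _ fun w => (propEval_imp w _ _).2 id)

end World

end GLP

/-- Kripke models of the logic `J`: the accessibility relations are transitive, jointly conversely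
well-founded, and related to each other by the two absorption laws. -/
structure JModel (W : Type) where
  R : ℕ → W → W → Prop
  V : ℕ → W → Prop
  wf : WellFounded fun y x => ∃ m, R m x y
  trans : ∀ {m x y z}, R m x y → R m y z → R m x z
  absorb_left : ∀ {j m x y z}, j < m → R m x y → (R j x z ↔ R j y z)
  absorb_right : ∀ {j m x y z}, j < m → R j x y → R m y z → R j x z

/-! ### Truth in J-models -/

namespace JModel

variable {W : Type} (M : JModel W)

/-- Truth at a world, where boxes below level `k` get their truth values from `o`. -/
def Forces (k : ℕ) (o : ModalFormula → Prop) : W → ModalFormula → Prop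
  | x, var p => M.V p x
  | _, bot => False
  | x, neg φ => ¬ Forces k o x φ
  | x, .and φ ψ => Forces k o x φ ∧ Forces k o x ψ
  | x, box m φ => if m < k then o (box m φ) else ∀ y, M.R m x y → Forces k o y φ

/-- Truth at a world. -/
abbrev Sat (x : W) (φ : ModalFormula) : Prop := M.Forces 0 (fun _ => False) x φ

theorem forces_box_of_le {k m : ℕ} (h : k ≤ m) (o : ModalFormula → Prop) (x : W)
    (φ : ModalFormula) :
    M.Forces k o x (box m φ) ↔ ∀ y, M.R m x y → M.Forces k o y φ := by
  simp [Forces, h.not_gt]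

theorem sat_box (m : ℕ) (x : W) (φ : ModalFormula) :
    M.Sat x (box m φ) ↔ ∀ y, M.R m x y → M.Sat y φ :=
  M.forces_box_of_le (Nat.zero_le m) _ x φ

/-- Monotonicity of the boxes for the boxed subformulas of a formula. -/
def MonotoneOn : ModalFormula → Prop
  | var _ => True
  | bot => True
  | neg φ => MonotoneOn φ
  | .and φ ψ => MonotoneOn φ ∧ MonotoneOn ψ
  | box j φ => (∀ m, j < m → ∀ x, M.Sat x (box j φ) → M.Sat x (box m φ)) ∧ MonotoneOn φ

/-- Monotonicity of the boxes from level `k` on, for all formulas and all interpretations of the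
boxes below level `k`. -/
def MonotoneFrom (k : ℕ) : Prop :=
  ∀ (o : ModalFormula → Prop) (φ : ModalFormula) (j m : ℕ) (x : W), k ≤ j → j < m →
    M.Forces k o x (box j φ) → M.Forces k o x (box m φ)

/-- The reflexive closure of the union of the relations above level `k`. -/
def ReachAbove (k : ℕ) (u x : W) : Prop := u = x ∨ ∃ m, k < m ∧ M.R m u x

variable {M}

theorem ReachAbove.rel_iff {k j : ℕ} {u x v : W} (h : M.ReachAbove k u x) (hj : j ≤ k) :
    M.R j x v ↔ M.R j u v := by
  rcases h with rfl | ⟨m, hm, h⟩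
  · rfl
  · exact (M.absorb_left (hj.trans_lt hm) h).symm

theorem ReachAbove.rel_right {k j : ℕ} {u x v : W} (h : M.ReachAbove k u x) (hj : j ≤ k)
    (hv : M.R j v u) : M.R j v x := by
  rcases h with rfl | ⟨m, hm, h⟩
  · exact hv
  · exact M.absorb_right (hj.trans_lt hm) hv h

/-- By transitivity and the absorption laws, a composition of two relations is contained in the one
of smaller index. -/
theorem rel_above_comp {k m : ℕ} {u x y : W} (h : ∃ i, k < i ∧ M.R i u x) (hm : k < m)
    (hy : M.R m x y) : ∃ i, k < i ∧ M.R i u y := by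
  obtain ⟨i, hi, h⟩ := h
  rcases lt_trichotomy i m with him | rfl | him
  · exact ⟨i, hi, M.absorb_right him h hy⟩
  · exact ⟨i, hi, M.trans h hy⟩
  · exact ⟨m, hm, (M.absorb_left him h).2 hy⟩

theorem ReachAbove.above {k m : ℕ} {u x y : W} (h : M.ReachAbove k u x) (hm : k < m)
    (hy : M.R m x y) : ∃ i, k < i ∧ M.R i u y := by
  rcases h with rfl | h
  · exact ⟨m, hm, hy⟩
  · exact rel_above_comp h hm hy

/-! ### Ordinal scales -/

variable (M)

/-- A well-order `E` of levels with a relation telling which worlds are present at which levels,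
such that a world is present cofinally below every level of its predecessors. -/
structure Scale (E : Type) [LinearOrder E] where
  wf : WellFoundedLT E
  P : W → E → Prop
  exists_level : ∀ x, ∃ e, P x e
  exists_lt : ∀ {x e}, P x e → ∃ f, f < e
  of_rel : ∀ {m x y e}, M.R m x y → P x e → P y e
  cofinal : ∀ {m x y e f}, M.R m x y → P x e → f < e → ∃ g, f < g ∧ g < e ∧ P y g

-- A world of rank ρ is present at the nonzero multiples of ω^ρ. A successor has smaller rank ρ',
-- and each nonzero multiple of ω^(ρ'+1) is a limit of multiples of ω^ρ'.
open Ordinal in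
theorem exists_scale : ∃ (E : Type) (_ : LinearOrder E), Nonempty (M.Scale E) := by
  let S : W → W → Prop := fun y x => ∃ m, M.R m x y
  have : IsWellFounded W S := ⟨M.wf⟩
  let ρ : W → Ordinal.{0} := IsWellFounded.rank S
  have hρ : ∀ {m x y}, M.R m x y → ρ y < ρ x := fun h => IsWellFounded.rank_lt_of_rel ⟨_, h⟩
  let B : Ordinal.{0} := Order.succ (ω ^ (⨆ x, ρ x))
  have hlt : ∀ x, ω ^ ρ x < B := fun x => Order.lt_succ_of_le
    (opow_le_opow_right omega0_pos (Ordinal.le_iSup ρ x))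
  refine ⟨B.ToType, inferInstance, ⟨{
    wf := inferInstance
    P := fun x e => (e.toOrd : Ordinal) ≠ 0 ∧ ω ^ ρ x ∣ (e.toOrd : Ordinal)
    exists_level := fun x => ⟨ToType.mk ⟨ω ^ ρ x, hlt x⟩, ?_, ?_⟩
    exists_lt := ?_
    of_rel := ?_
    cofinal := ?_ }⟩⟩
  · simp
  · simp
  · intro x e he
    refine ⟨ToType.mk ⟨0, (zero_le).trans_lt (hlt x)⟩, ?_⟩
    rw [← OrderIso.lt_symm_apply]
    exact Subtype.mk_lt_mk.2 (pos_iff_ne_zero.2 he.1)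
  · intro m x y e h he
    exact ⟨he.1, (opow_dvd_opow ω (hρ h).le).trans he.2⟩
  · intro m x y e f h he hf
    have hf' : (f.toOrd : Ordinal) < e.toOrd := ToType.mk.symm.lt_iff_lt.2 hf
    obtain ⟨c, hc⟩ := (opow_dvd_opow ω (Order.succ_le_of_lt (hρ h))).trans he.2
    have hc0 : 0 < c := by
      rw [pos_iff_ne_zero]
      rintro rfl
      exact he.1 (by simpa using hc)
    have hy0 : ω ^ ρ y ≠ 0 := opow_ne_zero _ omega0_ne_zero
    rw [opow_succ, mul_assoc] at hc
    set g : Ordinal := ω ^ ρ y * Order.succ ((f.toOrd : Ordinal) / ω ^ ρ y) with hg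
    -- g is the least multiple of ω^(ρ y) above f; it stays below e because e is ω^(ρ y) times a
    -- limit ordinal.
    have hfg : (f.toOrd : Ordinal) < g := lt_mul_succ_div _ hy0
    have hge : g < e.toOrd := by
      rw [hc, hg, mul_lt_mul_iff_right₀ (pos_iff_ne_zero.2 hy0)]
      refine (isSuccLimit_mul_left isSuccLimit_omega0 hc0).succ_lt ?_
      rw [← lt_mul_iff_div_lt hy0, ← hc]
      exact hf'
    have hgB : g < B := hge.trans e.toOrd.2
    refine ⟨ToType.mk ⟨g, hgB⟩, ?_, ?_, ?_, ?_⟩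
    · rw [← OrderIso.symm_apply_lt]
      exact hfg
    · rw [← OrderIso.lt_symm_apply]
      exact hge
    · simpa using (zero_le.trans_lt hfg).ne'
    · simp [hg]

/-! ### Expansion of a model at one level -/

variable {M} {E : Type} [LinearOrder E] (σ : M.Scale E) (k : ℕ)

/-- The worlds of the expansion of a model at level `k`: a world `x` above a root `u`, placed at a
level of the scale. -/
structure BlowUp where
  u : W
  x : W
  e : E
  reach : M.ReachAbove k u x
  present : σ.P x e

variable {σ k}

/-- The accessibility relations of the expansion at level `k`. -/
def BlowUp.Rel (m : ℕ) (a b : BlowUp σ k) : Prop :=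
  (m ≤ k ∧ M.R m a.x b.u) ∨
  (m = k ∧ a.u = b.u ∧ (∃ i, k < i ∧ M.R i a.u b.x) ∧ b.e < a.e) ∨
  (k < m ∧ a.u = b.u ∧ a.e = b.e ∧ M.R m a.x b.x)

/-- By absorption x and its root u have the same successors up to level k, so these relations see
only the root and the level. -/
theorem BlowUp.rel_iff_of_le {m : ℕ} {a b : BlowUp σ k} (h : m ≤ k) :
    Rel m a b ↔ M.R m a.u b.u ∨
      (m = k ∧ a.u = b.u ∧ (∃ i, k < i ∧ M.R i a.u b.x) ∧ b.e < a.e) := by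
  simp [Rel, h, h.not_gt, a.reach.rel_iff h]

theorem BlowUp.rel_iff_of_gt {m : ℕ} {a b : BlowUp σ k} (h : k < m) :
    Rel m a b ↔ a.u = b.u ∧ a.e = b.e ∧ M.R m a.x b.x := by
  simp [Rel, h.ne', h.not_ge, h]

variable (σ k)

/-- The expansion of a model at level `k`. -/
def blowUp : JModel (BlowUp σ k) where
  R := BlowUp.Rel
  V p a := M.V p a.x
  wf := by
    have := σ.wf
    -- Each edge moves the root u along a relation of M, or keeps u and lowers e, or keeps both and
    -- moves x.
    have h := WellFounded.prod_lex M.wf (WellFounded.prod_lex (wellFounded_lt (α := E)) M.wf)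
    refine Subrelation.wf (r := InvImage _ fun a : BlowUp σ k => (a.u, a.e, a.x)) ?_
      (InvImage.wf _ h)
    rintro b a ⟨m, hm⟩
    rcases le_or_gt m k with hmk | hmk
    · rcases (BlowUp.rel_iff_of_le hmk).1 hm with h | ⟨-, hu, -, he⟩
      · exact Prod.Lex.left _ _ ⟨m, h⟩
      · simp only [InvImage, hu]
        exact Prod.Lex.right _ (Prod.Lex.left _ _ he)
    · obtain ⟨hu, he, hx⟩ := (BlowUp.rel_iff_of_gt hmk).1 hm
      simp only [InvImage, hu, he]
      exact Prod.Lex.right _ (Prod.Lex.right _ ⟨m, hx⟩)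
  trans := by
    intro m a b c hab hbc
    rcases le_or_gt m k with hmk | hmk
    · rw [BlowUp.rel_iff_of_le hmk] at hab hbc ⊢
      rcases hab with h | ⟨rfl, hu, -, he⟩
      · rcases hbc with h' | ⟨-, hu', -, -⟩
        · exact .inl (M.trans h h')
        · exact .inl (hu' ▸ h)
      · rcases hbc with h' | ⟨-, hu', hi', he'⟩
        · exact .inl (hu ▸ h')
        · exact .inr ⟨rfl, hu.trans hu', hu ▸ hi', he'.trans he⟩
    · rw [BlowUp.rel_iff_of_gt hmk] at hab hbc ⊢
      exact ⟨hab.1.trans hbc.1, hab.2.1.trans hbc.2.1, M.trans hab.2.2 hbc.2.2⟩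
  absorb_left := by
    intro j m a b c hjm hab
    rcases le_or_gt m k with hmk | hmk
    · have hjk : j < k := hjm.trans_le hmk
      rw [BlowUp.rel_iff_of_le hmk] at hab
      simp only [BlowUp.rel_iff_of_le hjk.le, hjk.ne, false_and, or_false]
      rcases hab with h | ⟨-, hu, -⟩
      · exact M.absorb_left hjm h
      · rw [hu]
    · obtain ⟨hu, he, hx⟩ := (BlowUp.rel_iff_of_gt hmk).1 hab
      rcases le_or_gt j k with hjk | hjk
      · simp only [BlowUp.rel_iff_of_le hjk, hu, he]
      · simp only [BlowUp.rel_iff_of_gt hjk, hu, he, M.absorb_left hjm hx]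
  absorb_right := by
    intro j m a b c hjm hab hbc
    rcases le_or_gt m k with hmk | hmk
    · have hjk : j < k := hjm.trans_le hmk
      rw [BlowUp.rel_iff_of_le hmk] at hbc
      simp only [BlowUp.rel_iff_of_le hjk.le, hjk.ne, false_and, or_false] at hab ⊢
      rcases hbc with h | ⟨-, hu, -⟩
      · exact M.absorb_right hjm hab h
      · rwa [← hu]
    · obtain ⟨hu, he, hx⟩ := (BlowUp.rel_iff_of_gt hmk).1 hbc
      rcases le_or_gt j k with hjk | hjk
      · rw [BlowUp.rel_iff_of_le hjk] at hab ⊢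
        rcases hab with h | ⟨rfl, hu', hi, he'⟩
        · exact .inl (hu ▸ h)
        · exact .inr ⟨rfl, hu'.trans hu, rel_above_comp hi hmk hx, he ▸ he'⟩
      · rw [BlowUp.rel_iff_of_gt hjk] at hab ⊢
        exact ⟨hab.1.trans hu, hab.2.1.trans he, M.absorb_right hjm hab.2.2 hx⟩

variable {σ k}

/-- The successor of `a` in the same copy of the base model. -/
def BlowUp.move (a : BlowUp σ k) {m : ℕ} (hm : k < m) {y : W} (h : M.R m a.x y) : BlowUp σ k :=
  ⟨a.u, y, a.e, .inr (a.reach.above hm h), σ.of_rel h a.present⟩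

theorem BlowUp.rel_move (a : BlowUp σ k) {m : ℕ} (hm : k < m) {y : W} (h : M.R m a.x y) :
    Rel m a (a.move hm h) :=
  (rel_iff_of_gt hm).2 ⟨rfl, rfl, h⟩

theorem BlowUp.exists_rel_of_le (a : BlowUp σ k) {m : ℕ} (hm : m ≤ k) {y : W}
    (h : M.R m a.x y) : ∃ b : BlowUp σ k, b.x = y ∧ Rel m a b := by
  obtain ⟨e, he⟩ := σ.exists_level y
  exact ⟨⟨y, y, e, .inl rfl, he⟩, rfl, .inl ⟨hm, h⟩⟩

theorem BlowUp.exists_rel (a : BlowUp σ k) {m : ℕ} {y : W}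
    (h : M.R m a.x y) : ∃ b : BlowUp σ k, b.x = y ∧ Rel m a b := by
  rcases le_or_gt m k with hm | hm
  · exact a.exists_rel_of_le hm h
  · exact ⟨a.move hm h, rfl, a.rel_move hm h⟩

/-- Boxes that are monotone in the base model remain true of all successors in the expansion. -/
theorem BlowUp.sat_of_rel {j m : ℕ} (hjm : j ≤ m) {φ : ModalFormula}
    (H : ∀ i, j < i → ∀ x, M.Sat x (box j φ) → M.Sat x (box i φ)) {a b : BlowUp σ k}
    (hab : Rel m a b) (ha : M.Sat a.x (box j φ)) : M.Sat b.x φ := by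
  have H' : ∀ i, j ≤ i → ∀ x, M.Sat x (box j φ) → M.Sat x (box i φ) := by
    intro i hi
    rcases hi.eq_or_lt with rfl | hi
    · exact fun _ => id
    · exact H i hi
  rcases hab with ⟨hm, h⟩ | ⟨rfl, -, ⟨i, hi, h⟩, -⟩ | ⟨-, -, -, h⟩
  · exact (M.sat_box _ _ _).1 (H' m hjm _ ha) _ (b.reach.rel_right hm h)
  -- An added edge ends at an R_i-successor of the root with i > k. The box passes from a.x down to
  -- the root by absorption, and then from j up to i by monotonicity.
  · have hu : M.Sat a.u (box j φ) := by
      rw [sat_box] at ha ⊢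
      exact fun y hy => ha y ((a.reach.rel_iff hjm).2 hy)
    exact (M.sat_box _ _ _).1 (H' i (hjm.trans hi.le) _ hu) _ h
  · exact (M.sat_box _ _ _).1 (H' m hjm _ ha) _ h

/-- Every edge of the base model lifts to the expansion, and monotonicity on φ keeps the added edges
from falsifying its boxes. -/
theorem sat_blowUp_iff {φ : ModalFormula} (hφ : M.MonotoneOn φ) (a : BlowUp σ k) :
    (blowUp σ k).Sat a φ ↔ M.Sat a.x φ := by
  induction φ generalizing a with
  | var p => rfl
  | bot => rfl
  | neg φ ih => exact not_congr (ih hφ a)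
  | and φ ψ ih₁ ih₂ => exact and_congr (ih₁ hφ.1 a) (ih₂ hφ.2 a)
  | box m φ ih =>
    constructor
    · intro h
      rw [sat_box] at h ⊢
      intro y hy
      obtain ⟨b, rfl, hb⟩ := a.exists_rel hy
      exact (ih hφ.2 b).1 (h b hb)
    · intro h
      rw [sat_box]
      intro b hb
      exact (ih hφ.2 b).2 (BlowUp.sat_of_rel le_rfl hφ.1 hb h)

theorem monotoneOn_blowUp {φ : ModalFormula} (hφ : M.MonotoneOn φ) :
    (blowUp σ k).MonotoneOn φ := by
  induction φ with
  | var p => trivial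
  | bot => trivial
  | neg φ ih => exact ih hφ
  | and φ ψ ih₁ ih₂ => exact ⟨ih₁ hφ.1, ih₂ hφ.2⟩
  | box j φ ih =>
    refine ⟨fun m hm a ha => ?_, ih hφ.2⟩
    rw [sat_blowUp_iff hφ] at ha
    rw [sat_box]
    intro b hb
    exact (sat_blowUp_iff hφ.2 b).2 (BlowUp.sat_of_rel hm.le hφ.1 hb ha)

/-- The truth values of the boxes up to level `k` in one copy of the base model. -/
def BlowUp.oracle (o : ModalFormula → Prop) (a : BlowUp σ k) : ModalFormula → Prop
  | box j φ => (j < k → o (box j φ)) ∧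
      (j = k → ∀ b, Rel k a b → (blowUp σ k).Forces k o b φ)
  | _ => True

theorem BlowUp.rel_congr {a b c : BlowUp σ k} (hu : a.u = b.u) (he : a.e = b.e) :
    Rel k a c ↔ Rel k b c := by
  simp only [rel_iff_of_le le_rfl, hu, he]

/-- Boxes of level k are constant on a copy, since R_k depends only on (u, e), and lower boxes are
read from `o`. A copy is therefore the base model with one more level of boxes given by an oracle;
this is why `MonotoneFrom` quantifies over all oracles. -/
theorem forces_blowUp_iff (o : ModalFormula → Prop) (a b : BlowUp σ k) (hu : a.u = b.u)
    (he : a.e = b.e) (φ : ModalFormula) :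
    (blowUp σ k).Forces k o b φ ↔ M.Forces (k + 1) (a.oracle o) b.x φ := by
  induction φ generalizing b with
  | var p => rfl
  | bot => rfl
  | neg φ ih => exact not_congr (ih b hu he)
  | and φ ψ ih₁ ih₂ => exact and_congr (ih₁ b hu he) (ih₂ b hu he)
  | box m φ ih =>
    rcases lt_trichotomy m k with hm | rfl | hm
    · simp [Forces, hm, hm.ne, Nat.lt_succ_of_lt hm, BlowUp.oracle]
    · simp [Forces, BlowUp.oracle, blowUp, BlowUp.rel_congr hu he]
    · rw [forces_box_of_le _ hm.le, forces_box_of_le _ hm]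
      constructor
      · intro h y hy
        exact (ih (b.move hm hy) hu he).1 (h _ (b.rel_move hm hy))
      · intro h c hc
        obtain ⟨hu', he', hx⟩ := (BlowUp.rel_iff_of_gt hm).1 hc
        exact (ih c (hu.trans hu') (he.trans he')).2 (h _ hx)

/-- Truth of a formula in the copies of a part of the base model does not change any more close
below a given level. -/
theorem forces_eventually (o : ModalFormula → Prop) (u : W) (e f₀ : E) (hf₀ : f₀ < e)
    (φ : ModalFormula) :
    ∃ f, f < e ∧ ∀ a b : BlowUp σ k, a.u = u → b.u = u → a.x = b.x → a.e = e → f < b.e →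
      b.e < e → ((blowUp σ k).Forces k o a φ ↔ (blowUp σ k).Forces k o b φ) := by
  induction φ with
  | var p =>
    refine ⟨f₀, hf₀, fun a b _ _ hx _ _ _ => ?_⟩
    simp [Forces, blowUp, hx]
  | bot => exact ⟨f₀, hf₀, fun a b _ _ _ _ _ _ => Iff.rfl⟩
  | neg φ ih =>
    obtain ⟨f, hf, h⟩ := ih
    exact ⟨f, hf, fun a b h₁ h₂ h₃ h₄ h₅ h₆ => not_congr (h a b h₁ h₂ h₃ h₄ h₅ h₆)⟩
  | and φ ψ ih₁ ih₂ =>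
    obtain ⟨f, hf, h⟩ := ih₁
    obtain ⟨g, hg, h'⟩ := ih₂
    exact ⟨max f g, max_lt hf hg, fun a b h₁ h₂ h₃ h₄ h₅ h₆ => and_congr
      (h a b h₁ h₂ h₃ h₄ ((le_max_left f g).trans_lt h₅) h₆)
      (h' a b h₁ h₂ h₃ h₄ ((le_max_right f g).trans_lt h₅) h₆)⟩
  | box m φ ih =>
    rcases lt_trichotomy m k with hm | rfl | hm
    · refine ⟨f₀, hf₀, fun a b _ _ _ _ _ _ => ?_⟩
      simp [Forces, hm]
    -- A counterexample in a copy c below e falsifies the box at every level above c.e. Without one,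
    -- added edges never falsify it up to e, and the other R_k-edges depend only on u.
    · by_cases hw : ∃ c : BlowUp σ m, c.u = u ∧ (∃ i, m < i ∧ M.R i u c.x) ∧ c.e < e ∧
          ¬ (blowUp σ m).Forces m o c φ
      · obtain ⟨c, hcu, hi, hce, hc⟩ := hw
        refine ⟨c.e, hce, fun a b h₁ h₂ h₃ h₄ h₅ h₆ => ?_⟩
        rw [forces_box_of_le _ le_rfl, forces_box_of_le _ le_rfl]
        refine iff_of_false (fun h => hc (h c ?_)) (fun h => hc (h c ?_))
        · exact (BlowUp.rel_iff_of_le le_rfl).2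
            (.inr ⟨rfl, h₁.trans hcu.symm, h₁ ▸ hi, h₄ ▸ hce⟩)
        · exact (BlowUp.rel_iff_of_le le_rfl).2 (.inr ⟨rfl, h₂.trans hcu.symm, h₂ ▸ hi, h₅⟩)
      · push Not at hw
        refine ⟨f₀, hf₀, fun a b h₁ h₂ h₃ h₄ h₅ h₆ => ?_⟩
        rw [forces_box_of_le _ le_rfl, forces_box_of_le _ le_rfl]
        constructor
        · intro h c hc
          rcases (BlowUp.rel_iff_of_le le_rfl).1 hc with hc | ⟨-, hu, hi, he⟩
          · exact h c ((BlowUp.rel_iff_of_le le_rfl).2 (.inl (by rwa [h₁, ← h₂])))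
          · exact hw c (hu.symm.trans h₂) (h₂ ▸ hi) (he.trans h₆)
        · intro h c hc
          rcases (BlowUp.rel_iff_of_le le_rfl).1 hc with hc | ⟨-, hu, hi, he⟩
          · exact h c ((BlowUp.rel_iff_of_le le_rfl).2 (.inl (by rwa [h₂, ← h₁])))
          · exact hw c (hu.symm.trans h₁) (h₁ ▸ hi) (h₄ ▸ he)
    · obtain ⟨f, hf, h⟩ := ih
      refine ⟨f, hf, fun a b h₁ h₂ h₃ h₄ h₅ h₆ => ?_⟩
      rw [forces_box_of_le _ hm.le, forces_box_of_le _ hm.le]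
      constructor
      · intro H c hc
        obtain ⟨hu, he, hx⟩ := (BlowUp.rel_iff_of_gt hm).1 hc
        have hx' : M.R m a.x c.x := h₃ ▸ hx
        exact (h (a.move hm hx') c h₁ (hu.symm.trans h₂) rfl h₄ (he ▸ h₅) (he ▸ h₆)).1
          (H _ (a.rel_move hm hx'))
      · intro H c hc
        obtain ⟨hu, he, hx⟩ := (BlowUp.rel_iff_of_gt hm).1 hc
        have hx' : M.R m b.x c.x := h₃ ▸ hx
        exact (h c (b.move hm hx') (hu.symm.trans h₁) h₂ rfl (he.symm.trans h₄) h₅ h₆).2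
          (H _ (b.rel_move hm hx'))

/-- For j = k, an R_m-successor b of a is compared with the same world in a lower copy, close enough
to b.e to agree on φ. Cofinality of the scale supplies that copy, and an added R_k-edge leads there
from a. For j > k everything happens inside one copy of the base model. -/
theorem monotoneFrom_blowUp (hM : M.MonotoneFrom (k + 1)) : (blowUp σ k).MonotoneFrom k := by
  intro o φ j m a hkj hjm ha
  rcases hkj.eq_or_lt with rfl | hkj
  · rw [forces_box_of_le _ hjm.le]
    rw [forces_box_of_le _ le_rfl] at ha
    intro b hb
    obtain ⟨hu, he, hx⟩ := (BlowUp.rel_iff_of_gt hjm).1 hb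
    obtain ⟨f₀, hf₀⟩ := σ.exists_lt b.present
    obtain ⟨f, hf, h⟩ := forces_eventually (σ := σ) (k := k) o b.u b.e f₀ hf₀ φ
    obtain ⟨g, hfg, hge, hg⟩ := σ.cofinal hx a.present (he ▸ hf)
    rw [he] at hge
    refine (h b ⟨b.u, b.x, g, b.reach, hg⟩ rfl rfl rfl rfl hfg hge).2 (ha _ ?_)
    exact (BlowUp.rel_iff_of_le le_rfl).2
      (.inr ⟨rfl, hu, a.reach.above hjm hx, by rwa [he]⟩)
  · rw [forces_blowUp_iff o a a rfl rfl] at ha ⊢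
    exact hM _ φ j m a.x hkj hjm ha

theorem exists_monotoneFrom_zero (n : ℕ) : ∀ {W : Type} (M : JModel W) (φ : ModalFormula) (x : W),
    M.MonotoneFrom n → M.MonotoneOn φ → ¬ M.Sat x φ →
    ∃ (W' : Type) (M' : JModel W') (y : W'), M'.MonotoneFrom 0 ∧ ¬ M'.Sat y φ := by
  induction n with
  | zero => exact fun M φ x h _ hx => ⟨_, M, x, h, hx⟩
  | succ n ih =>
    intro W M φ x h hφ hx
    obtain ⟨E, _, ⟨σ⟩⟩ := M.exists_scale
    obtain ⟨e, he⟩ := σ.exists_level x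
    exact ih (blowUp σ n) φ ⟨x, x, e, .inl rfl, he⟩ (monotoneFrom_blowUp h)
      (monotoneOn_blowUp hφ) fun h' => hx ((sat_blowUp_iff hφ _).1 h')

/-! ### Soundness -/

theorem sat_subst (M : JModel W) (s : ℕ → ModalFormula) (x : W) (φ : ModalFormula) :
    M.Sat x (subst s φ) ↔ PropEval (fun ψ => M.Sat x (subst s ψ)) φ := by
  induction φ with
  | var p => rfl
  | bot => rfl
  | neg φ ih => exact not_congr ih
  | and φ ψ ih₁ ih₂ => exact and_congr ih₁ ih₂
  | box m φ _ => rfl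

theorem sat_imp (M : JModel W) (x : W) (φ ψ : ModalFormula) :
    M.Sat x (imp φ ψ) ↔ (M.Sat x φ → M.Sat x ψ) := by
  simp only [imp, Forces]
  tauto

theorem sat_neg (M : JModel W) (x : W) (φ : ModalFormula) :
    M.Sat x (neg φ) ↔ ¬ M.Sat x φ := Iff.rfl

theorem sat_loeb (M : JModel W) (m : ℕ) (x : W) (φ : ModalFormula)
    (h : M.Sat x (box m (imp (box m φ) φ))) : M.Sat x (box m φ) := by
  simp only [sat_box, sat_imp] at h ⊢
  intro y
  induction y using M.wf.induction with
  | _ y ih => exact fun hy => h y hy fun z hz => ih z ⟨m, hz⟩ (M.trans hy hz)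

/-- Soundness. -/
theorem sat_of_GLP (M : JModel W) (hM : M.MonotoneFrom 0) {φ : ModalFormula}
    (hφ : GLP (fun m n => m < n) φ) (s : ℕ → ModalFormula) (x : W) : M.Sat x (subst s φ) := by
  -- Quantifying over all substitutions absorbs the substitution rule.
  induction hφ generalizing s x with
  | tautology φ hφ => exact (M.sat_subst s x φ).2 (hφ _)
  | distrib ξ φ ψ =>
    change M.Sat x (imp (box ξ (imp _ _)) (imp (box ξ _) (box ξ _)))
    simp only [sat_imp, sat_box]
    exact fun h h' y hy => h y hy (h' y hy)
  | loeb ξ φ =>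
    change M.Sat x (imp (box ξ (imp (box ξ _) _)) (box ξ _))
    rw [sat_imp]
    exact M.sat_loeb ξ x _
  | monotone ξ ζ φ hr =>
    change M.Sat x (imp (neg (box ζ (neg _))) (neg (box ξ (neg _))))
    rw [sat_imp, sat_neg, sat_neg]
    exact mt (hM _ _ ξ ζ x (Nat.zero_le _) hr)
  | introspection ξ ζ φ hr =>
    change M.Sat x (imp (neg (box ξ (neg _))) (box ζ (neg (box ξ (neg _)))))
    rw [sat_imp, sat_box]
    intro h y hy
    rw [sat_neg, sat_box] at h ⊢
    exact fun h' => h fun z hz => h' z ((M.absorb_left hr hy).1 hz)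
  | modusPonens φ ψ _ _ h₁ h₂ => exact (M.sat_imp x _ _).1 (h₁ s x) (h₂ s x)
  | substitution t φ _ ih =>
    rw [subst_subst]
    exact ih _ x
  | necessitation ξ φ _ ih => exact (M.sat_box _ _ _).2 fun y _ => ih s y

end JModel

/-! ### The canonical model and conservativity -/

namespace GLP

variable {A : Finset ℕ} {B : Set ModalFormula}

/-- The relations of the canonical model for the logic whose order is restricted to `A`, relative
to the set `B` of formulas. -/
def CanonicalRel (A : Finset ℕ) (B : Set ModalFormula) (m : ℕ)
    (x y : World fun ξ ζ => ξ ∈ A ∧ ζ ∈ A ∧ ξ < ζ) : Prop :=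
  m ∈ A ∧ (∀ χ ∈ B, x.1 (box m χ) → PropEval y.1 χ ∧ y.1 (box m χ)) ∧
    (∀ j ∈ A, j < m → ∀ χ ∈ B, x.1 (box j χ) ↔ y.1 (box j χ)) ∧
    ∃ χ ∈ B, y.1 (box m χ) ∧ ¬ x.1 (box m χ)

/-- Counting the χ in B whose box fails, an R_m-step lowers the count at m and keeps those at j < m;
the vector of counts decreases lexicographically. -/
theorem wellFounded_canonicalRel (hB : B.Finite) :
    WellFounded fun y x => ∃ m, CanonicalRel A B m x y := by
  let f : (World fun ξ ζ => ξ ∈ A ∧ ζ ∈ A ∧ ξ < ζ) → A → ℕ :=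
    fun x j => {χ ∈ B | ¬ x.1 (box j χ)}.ncard
  have h := Pi.Lex.wellFounded (ι := A) (α := fun _ => ℕ) (s := fun {_} a b => a < b) (· < ·)
    fun _ => wellFounded_lt
  refine Subrelation.wf (r := InvImage _ f) ?_ (InvImage.wf f h)
  rintro y x ⟨m, hm, hsub, heq, χ, hχ, hy, hx⟩
  refine ⟨⟨m, hm⟩, fun j hj => ?_, ?_⟩
  · simp only [f]
    congr 1
    ext θ
    exact and_congr_right fun hθ => not_congr (heq j j.2 hj θ hθ).symm
  · refine Set.ncard_lt_ncard ?_ (hB.subset fun θ hθ => hθ.1)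
    refine ⟨fun θ hθ => ⟨hθ.1, fun h => hθ.2 (hsub θ hθ.1 h).2⟩, fun h => ?_⟩
    exact (h ⟨hχ, hx⟩).2 hy

/-- The canonical model. -/
def canonicalModel (A : Finset ℕ) (hB : B.Finite) :
    JModel (World fun ξ ζ => ξ ∈ A ∧ ζ ∈ A ∧ ξ < ζ) where
  R := CanonicalRel A B
  V p x := x.1 (var p)
  wf := wellFounded_canonicalRel hB
  trans := by
    rintro m x y z ⟨hm, h₁, h₂, χ, hχ, hy, hx⟩ ⟨-, h₁', h₂', -⟩
    exact ⟨hm, fun θ hθ h => h₁' θ hθ (h₁ θ hθ h).2,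
      fun j hj hjm θ hθ => (h₂ j hj hjm θ hθ).trans (h₂' j hj hjm θ hθ),
      χ, hχ, (h₁' χ hχ hy).2, hx⟩
  absorb_left := by
    rintro j m x y z hjm ⟨hm, h₁, h₂, -⟩
    refine and_congr_right fun hj => and_congr (forall₂_congr fun χ hχ => ?_) (and_congr
      (forall₂_congr fun i hi => forall_congr' fun hij => forall₂_congr fun χ hχ => ?_)
      (exists_congr fun χ => and_congr_right fun hχ => ?_))
    · rw [h₂ j hj hjm χ hχ]
    · rw [h₂ i hi (hij.trans hjm) χ hχ]
    · rw [h₂ j hj hjm χ hχ]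
  absorb_right := by
    rintro j m x y z hjm ⟨hj, h₁, h₂, χ, hχ, hy, hx⟩ ⟨hm, h₁', h₂', -⟩
    refine ⟨hj, fun θ hθ h => ?_, fun i hi hij θ hθ => ?_, χ, hχ,
      (h₂' j hj hjm χ hχ).1 hy, hx⟩
    · have hyθ := (h₁ θ hθ h).2
      exact ⟨(h₁' θ hθ (y.box_of_lt ⟨hj, hm, hjm⟩ hyθ)).1, (h₂' j hj hjm θ hθ).1 hyθ⟩
    · exact (h₂ i hi hij θ hθ).trans (h₂' i hi (hij.trans hjm) θ hθ)

theorem exists_canonicalRel {m : ℕ} (hm : m ∈ A) {φ : ModalFormula} (hφ : φ ∈ B)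
    (x : World fun ξ ζ => ξ ∈ A ∧ ζ ∈ A ∧ ξ < ζ) (h : ¬ x.1 (box m φ)) :
    ∃ y, CanonicalRel A B m x y ∧ ¬ PropEval y.1 φ := by
  obtain ⟨y, hyφ, hy, hxy⟩ := x.exists_of_not_box h
  refine ⟨y, ⟨hm, fun χ _ hx => ⟨hxy χ hx, hxy _ (x.box_box hx)⟩, fun j hj hjm χ _ => ⟨?_, ?_⟩,
    φ, hφ, hy, h⟩, hyφ⟩
  · exact fun hx => hxy (box j χ) (x.box_of_lt ⟨hj, hm, hjm⟩ (x.box_box hx))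
  · intro hyj
    by_contra hx
    exact hxy _ (x.box_neg_box ⟨hj, hm, hjm⟩ hx) hyj

theorem sat_canonicalModel_iff (hB : B.Finite) (φ : ModalFormula) (hA : modalities φ ⊆ A)
    (hφ : boxBodies φ ⊆ B) (x : World fun ξ ζ => ξ ∈ A ∧ ζ ∈ A ∧ ξ < ζ) :
    (canonicalModel A hB).Sat x φ ↔ PropEval x.1 φ := by
  induction φ generalizing x with
  | var p => rfl
  | bot => rfl
  | neg φ ih => exact not_congr (ih hA hφ x)
  | and φ ψ ih₁ ih₂ =>
    exact and_congr (ih₁ (Finset.union_subset_left hA) (Set.union_subset_iff.1 hφ).1 x)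
      (ih₂ (Finset.union_subset_right hA) (Set.union_subset_iff.1 hφ).2 x)
  | box m φ ih =>
    obtain ⟨hm, hA⟩ := Finset.insert_subset_iff.1 hA
    obtain ⟨hφB, hφ⟩ := Set.insert_subset_iff.1 hφ
    rw [JModel.sat_box]
    simp only [ih hA hφ, PropEval]
    constructor
    · intro h
      by_contra hx
      obtain ⟨y, hy, hyφ⟩ := exists_canonicalRel hm hφB x hx
      exact hyφ (h y hy)
    · exact fun h y hy => (hy.2.1 φ hφB h).1

/-- Axiom 3 is available only between modalities in A, but R_m is empty for m outside A. -/
theorem monotoneOn_canonicalModel (hB : B.Finite) (φ : ModalFormula) (hA : modalities φ ⊆ A)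
    (hφ : boxBodies φ ⊆ B) : (canonicalModel A hB).MonotoneOn φ := by
  induction φ with
  | var p => trivial
  | bot => trivial
  | neg φ ih => exact ih hA hφ
  | and φ ψ ih₁ ih₂ =>
    exact ⟨ih₁ (Finset.union_subset_left hA) (Set.union_subset_iff.1 hφ).1,
      ih₂ (Finset.union_subset_right hA) (Set.union_subset_iff.1 hφ).2⟩
  | box j φ ih =>
    have hsat := sat_canonicalModel_iff hB (box j φ) hA hφ
    obtain ⟨hj, hA⟩ := Finset.insert_subset_iff.1 hA
    obtain ⟨hφB, hφ⟩ := Set.insert_subset_iff.1 hφ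
    refine ⟨fun m hjm x hx => ?_, ih hA hφ⟩
    rw [JModel.sat_box]
    intro y hy
    have hxm := x.box_of_lt ⟨hj, hy.1, hjm⟩ ((hsat x).1 hx)
    exact (sat_canonicalModel_iff hB φ hA hφ y).2 (hy.2.1 φ hφB hxm).1

theorem monotoneFrom_canonicalModel (hB : B.Finite) {n : ℕ} (hn : ∀ m ∈ A, m ≤ n) :
    (canonicalModel A hB).MonotoneFrom n := by
  intro o φ j m x hnj hjm _
  rw [JModel.forces_box_of_le _ (hnj.trans hjm.le)]
  exact fun y hy => absurd (hn m hy.1) (hnj.trans_lt hjm).not_ge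

/-- `GLP` over the natural numbers is conservative over its fragments with finitely many
comparable modalities. -/
theorem of_lt {φ : ModalFormula} (hφ : GLP (fun m n => m < n) φ) :
    GLP (fun ξ ζ => ξ ∈ modalities φ ∧ ζ ∈ modalities φ ∧ ξ < ζ) φ := by
  by_contra h
  obtain ⟨v, hv, hvφ⟩ := (isTheory _).exists_valuation h
  have hB := finite_boxBodies φ
  obtain ⟨W, M, y, hM, hy⟩ := JModel.exists_monotoneFrom_zero ((modalities φ).sup id)
    (canonicalModel (modalities φ) hB) φ ⟨v, hv⟩
    (monotoneFrom_canonicalModel hB fun m hm => Finset.le_sup (f := id) hm)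
    (monotoneOn_canonicalModel hB φ subset_rfl subset_rfl)
    (fun h' => hvφ ((sat_canonicalModel_iff hB φ subset_rfl subset_rfl _).1 h'))
  exact hy (subst_var φ ▸ M.sat_of_GLP hM hφ var y)

end GLP

/-! ### Positions and transfer between orders -/

theorem orderPosition_lt_orderPosition (r : ℕ → ℕ → Prop) [IsStrictOrder ℕ r] (S : Finset ℕ)
    {ξ ζ : ℕ} (hξ : ξ ∈ S) (h : r ξ ζ) : orderPosition r S ξ < orderPosition r S ζ := by
  classical
  unfold orderPosition
  refine Finset.card_lt_card ⟨fun l hl => ?_, fun hsub => ?_⟩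
  · rw [Finset.mem_filter] at hl ⊢
    exact ⟨hl.1, trans_of r hl.2 h⟩
  · exact irrefl_of r ξ (Finset.mem_filter.1 (hsub (Finset.mem_filter.2 ⟨hξ, h⟩))).2

theorem orderPosition_lt_iff (r : ℕ → ℕ → Prop) [IsStrictTotalOrder ℕ r] (S : Finset ℕ)
    {ξ ζ : ℕ} (hξ : ξ ∈ S) (hζ : ζ ∈ S) :
    orderPosition r S ξ < orderPosition r S ζ ↔ r ξ ζ := by
  refine ⟨fun h => ?_, orderPosition_lt_orderPosition r S hξ⟩
  rcases trichotomous_of r ξ ζ with h' | rfl | h'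
  · exact h'
  · exact absurd h (lt_irrefl _)
  · exact absurd h (orderPosition_lt_orderPosition r S hζ h').not_gt

theorem orderPosition_injOn (r : ℕ → ℕ → Prop) [IsStrictTotalOrder ℕ r] (S : Finset ℕ) :
    Set.InjOn (orderPosition r S) S := by
  intro ξ hξ ζ hζ h
  rcases trichotomous_of r ξ ζ with h' | h' | h'
  · exact absurd h (orderPosition_lt_orderPosition r S hξ h').ne
  · exact h'
  · exact absurd h (orderPosition_lt_orderPosition r S hζ h').ne'

/-- Two renamings that order the modalities of a formula in the same way are equally provable. -/
theorem GLP.rename_of_rename (s : ℕ → ℕ → Prop) (g h : ℕ → ℕ) (φ : ModalFormula)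
    (hg : Set.InjOn g (modalities φ))
    (H : ∀ ξ ∈ modalities φ, ∀ ζ ∈ modalities φ, g ξ < g ζ → s (h ξ) (h ζ))
    (hφ : GLP (fun m n => m < n) (ModalFormula.rename g φ)) :
    GLP s (ModalFormula.rename h φ) := by
  -- Conservativity leaves comparisons only between values of g on the modalities of φ, where g has
  -- an inverse.
  have h₁ := hφ.of_lt.rename (r := s) (fun k => h (Function.invFunOn g (modalities φ) k)) (by
    simp only [modalities_rename, Finset.mem_image]
    rintro _ _ ⟨⟨ξ, hξ, rfl⟩, ⟨ζ, hζ, rfl⟩, hlt⟩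
    rw [hg.leftInvOn_invFunOn hξ, hg.leftInvOn_invFunOn hζ]
    exact H ξ hξ ζ hζ hlt)
  rw [rename_rename] at h₁
  rwa [rename_congr _ h φ fun k hk => congrArg h (hg.leftInvOn_invFunOn hk)] at h₁

theorem mainTheorem3 (r : ℕ → ℕ → Prop) (hwo : IsWellOrder ℕ r) (hrec : IsRecursiveRelation r)
    (φ : ModalFormula) :
    GLP r φ ↔ GLPomega (condensation r φ) := by
  constructor
  · intro hφ
    obtain ⟨S, hS⟩ := hφ.exists_finset
    -- The derivation may compare modalities outside φ, so positions are first taken in the larger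
    -- set S ∪ `modalities φ`.
    have h := (hS.mono (r := fun ξ ζ => ξ ∈ S ∪ modalities φ ∧ r ξ ζ) fun ξ ζ h =>
      ⟨Finset.mem_union_left _ h.1, h.2.2⟩).rename (r := fun m n => m < n)
      (orderPosition r (S ∪ modalities φ))
      fun ξ ζ h => orderPosition_lt_orderPosition r _ h.1 h.2
    have hmem : ∀ {ξ}, ξ ∈ modalities φ → ξ ∈ S ∪ modalities φ := Finset.mem_union_right _
    refine GLP.rename_of_rename _ _ _ φ
      ((orderPosition_injOn r _).mono fun ξ => hmem) (fun ξ hξ ζ hζ hlt => ?_) h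
    exact orderPosition_lt_orderPosition r _ hξ
      ((orderPosition_lt_iff r _ (hmem hξ) (hmem hζ)).1 hlt)
  · intro hφ
    rw [← rename_id φ]
    exact GLP.rename_of_rename _ _ (fun k => k) φ (orderPosition_injOn r _)
      (fun ξ hξ ζ hζ hlt => (orderPosition_lt_iff r _ hξ hζ).1 hlt) hφ
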